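/- **Theorem (Discrete Gauss-Bonnet theorem).** Let $X$ be the triangular lattice: its vertices are the points $k(1,0)+l(1,\sqrt3)/2$, $k,l\in\mathbb Z$, and two vertices are adjacent when their Euclidean distance is $1$. For a subgraph $G$ of $X$ and a vertex $p$ of $G$, the sphere $S_r(p)$ is the subgraph of $G$ whose vertices are the vertices of $G$ at geodesic distance $r$ from $p$ in $G$ and whose edges are all edges of $G$ between them; $|S_r(p)|$ denotes its number of edges. A vertex is $0$-dimensional if it has no neighbour, and $(n+1)$-dimensional if its unit sphere is non-empty and all vertices of the unit sphere are $n$-dimensional in it; a graph is $n$-dimensional if all its vertices are. A vertex $p$ of $G$ is interior if $S_1(p)$ in $G$ equals $S_1(p)$ in $X$, and is a boundary vertex if it is not interior but is adjacent in $G$ to an interior vertex. $G$ is a *domain* if (i) $G$ is $2$-dimensional; (ii) every vertex of $G$ is an interior or a boundary vertex; (iii) the graph induced on the boundary vertices is $1$-dimensional; (iv) vertices of $G$ that are adjacent in $X$ are adjacent in $G$; (v) two distinct interior vertices adjacent to a common boundary vertex are adjacent or are both adjacent to a third interior vertex. $G$ is a *smooth domain* if $G$ is a domain and its complement, the full subgraph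 of $X$ on the vertices not in $G$, is a domain too. Let $G$ be a finite smooth domain, let $C$ be its set of boundary vertices, put $K(p)=2|S_1(p)|-|S_2(p)|$ for $p\in C$, and let $\chi(G)=v-e+f$, where $v$, $e$, $f$ are the numbers of vertices, edges and triangles of $G$. Then $$\sum_{p\in C}K(p)=12\,\chi(G),$$ and the same identity holds if the spheres $S_r(p)$ in the definition of $K$ are formed with the distance of $X$ instead of the geodesic distance of $G$ (that is, from all vertices of $G$ at distance $r$ from $p$ in $X$). The identity with the geodesic distance of $G$ also holds for every finite domain $G$ for which the closed complement, the full subgraph of $X$ on all vertices that are not interior vertices of $G$, is a domain. -/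

import Mathlib

/-- The triangular lattice `X`. The vertex `(k, l)` stands for the point
`k (1, 0) + l (1, √3) / 2` of the plane, whose squared Euclidean norm is `k² + k l + l²`.
Two vertices are adjacent when their Euclidean distance is `1`. -/
def triLattice : SimpleGraph (ℤ × ℤ) where
  Adj p q := (p.1 - q.1) ^ 2 + (p.1 - q.1) * (p.2 - q.2) + (p.2 - q.2) ^ 2 = 1
  symm := ⟨fun p q h => by
    have e : (q.1 - p.1) ^ 2 + (q.1 - p.1) * (q.2 - p.2) + (q.2 - p.2) ^ 2 =
      (p.1 - q.1) ^ 2 + (p.1 - q.1) * (p.2 - q.2) + (p.2 - q.2) ^ 2 := by ring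
    exact e.trans h⟩
  loopless := ⟨fun p h => by simp at h⟩

namespace TriLattice

/-- Subgraphs `(V, E)` of the triangular lattice, finite or infinite. -/
abbrev Sub := triLattice.Subgraph

/-- The full subgraph of the lattice on a set of vertices. -/
def full (S : Set (ℤ × ℤ)) : Sub := (⊤ : Sub).induce S

/-- The sphere `S_r(p)` in `G`: its vertices are the vertices of `G` at geodesic distance `r`
from `p` in the graph `G`, its edges are the edges of `G` between such vertices. -/
def sphere (G : Sub) (p : ℤ × ℤ) (r : ℕ) : Sub :=
  G.induce {q | q ∈ G.verts ∧ G.spanningCoe.edist p q = r}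

/-- The variant of `S_r(p)` in which the distance is measured in the whole lattice:
all vertices of `G` at lattice distance `r` from `p`, with the edges of `G` between them. -/
def latticeSphere (G : Sub) (p : ℤ × ℤ) (r : ℕ) : Sub :=
  G.induce {q | q ∈ G.verts ∧ triLattice.edist p q = r}

/-- The inductive dimension of a vertex: a vertex is `0`-dimensional when it has no neighbour, and
`(n+1)`-dimensional when its unit sphere is an `n`-dimensional graph (with at least one vertex),
that is, every vertex of the unit sphere is `n`-dimensional in the unit sphere. -/
def PointDim : ℕ → Sub → ℤ × ℤ → Prop
  | 0, G, p => ∀ q, ¬ G.Adj p q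
  | n + 1, G, p =>
      (sphere G p 1).verts.Nonempty ∧ ∀ q ∈ (sphere G p 1).verts, PointDim n (sphere G p 1) q

/-- A graph is `n`-dimensional when all its vertices are. -/
def HasDim (n : ℕ) (G : Sub) : Prop := ∀ p ∈ G.verts, PointDim n G p

/-- Interior vertices: the unit sphere in `G` is the unit sphere in the lattice. -/
def interior (G : Sub) : Set (ℤ × ℤ) :=
  {p | p ∈ G.verts ∧ sphere G p 1 = sphere ⊤ p 1}

/-- Boundary vertices: not interior, but adjacent to an interior vertex. -/
def boundary (G : Sub) : Set (ℤ × ℤ) :=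
  {p | p ∈ G.verts ∧ p ∉ interior G ∧ ∃ q ∈ interior G, G.Adj p q}

/-- Domains in the triangular lattice. -/
structure IsDomain (G : Sub) : Prop where
  two_dim : HasDim 2 G
  interior_or_boundary : ∀ p ∈ G.verts, p ∈ interior G ∨ p ∈ boundary G
  boundary_one_dim : HasDim 1 (G.induce (boundary G))
  edges : ∀ p ∈ G.verts, ∀ q ∈ G.verts, triLattice.Adj p q → G.Adj p q
  common_boundary : ∀ p ∈ interior G, ∀ q ∈ interior G, p ≠ q →
    (∃ b ∈ boundary G, G.Adj p b ∧ G.Adj q b) →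
      G.Adj p q ∨ ∃ r ∈ interior G, G.Adj p r ∧ G.Adj q r

/-- The complement of `G`: the full subgraph on the vertices outside `G`. -/
def compl (G : Sub) : Sub := full G.vertsᶜ

/-- The closed complement of `G`: the full subgraph on the vertices that are not interior
vertices of `G` (so that it contains the boundary of `G`). -/
def closedCompl (G : Sub) : Sub := full (interior G)ᶜ

/-- Smooth domains: domains whose complement is a domain too. -/
def IsSmoothDomain (G : Sub) : Prop := IsDomain G ∧ IsDomain (compl G)

/-- The arc length of a sphere: its number of edges. -/
noncomputable def arcLength (S : Sub) : ℤ := S.edgeSet.ncard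

/-- The curvature `K(p) = 2 |S_1(p)| - |S_2(p)|`. -/
noncomputable def curvature (G : Sub) (p : ℤ × ℤ) : ℤ :=
  2 * arcLength (sphere G p 1) - arcLength (sphere G p 2)

/-- The curvature computed from the spheres in which distances are measured in the lattice. -/
noncomputable def latticeCurvature (G : Sub) (p : ℤ × ℤ) : ℤ :=
  2 * arcLength (latticeSphere G p 1) - arcLength (latticeSphere G p 2)

/-- The Euler characteristic `v - e + f` (used for finite `G`); a face is a set of three vertices
that are pairwise joined by edges of `G`. -/
noncomputable def eulerChar (G : Sub) : ℤ :=
  (G.verts.ncard : ℤ) - G.edgeSet.ncard + (G.spanningCoe.cliqueSet 3).ncard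

end TriLattice

/-!
The identity is a double count, and the geodesic version holds for every finite domain.

*Local structure.* A domain `G` is a full subgraph of the lattice, so a vertex is interior exactly
when all its six neighbours belong to `G`. Let `p` be a boundary vertex. Two-dimensionality, the
adjacency to an interior vertex, the one-dimensionality of the boundary and the condition on common
boundary vertices force the neighbours of `p` in `G` to form one arc of three, four or five
consecutive vertices of the surrounding hexagon, the two ends of the arc being boundary vertices and
all others interior (`Pattern.count_of_start`, which treats the three cases after a rotation of the
lattice). Hence `p` has two boundary neighbours `a` and `z`, and `deg p - 1` triangles at `p`.

*Curvature.* The `m - 2` interior neighbours of a boundary vertex `p` of degree `m` put a path of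
`2 m - 3` vertices on the sphere `S_2(p)`, and `a` and `z` prolong it by `deg a - 3` and `deg z - 3`
vertices. As the whole ring at distance two has twelve vertices, the path does not close up. So
`|S_2(p)| = 2 m - 4 + (deg a - 3) + (deg z - 3)` and `K(p) = (4 - deg a) + (4 - deg z)`
(`IsDomain.curvature_eq`). Each boundary vertex being a boundary neighbour twice, the sum of the
curvatures is `2 ∑ (4 - deg q)` over the boundary.

*Euler characteristic.* Counting edges and triangles at their vertices,
`6 χ(G) = ∑ (6 - 3 deg q + 2 tri q)` over all vertices; an interior vertex contributes
`6 - 18 + 12 = 0`, a boundary vertex `4 - deg q` (`six_mul_eulerChar`).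

*Lattice distance.* The spheres formed with the lattice distance agree with the geodesic ones when
the complement is a domain (`latticeSphere_two`): if `q` in `G` is at lattice distance two from `p`
and no common neighbour is in `G`, a common neighbour in the complement has there either an isolated
point on its unit sphere, or no three consecutive neighbours.
-/

namespace TriLattice

/-! ### The six directions of the lattice -/

/-- The six unit vectors of the lattice in counterclockwise order, indexed cyclically:
`dir k` is `dir 0` turned by `60 k` degrees. -/
def dir : Fin 6 → ℤ × ℤ := ![(1, 0), (0, 1), (-1, 1), (-1, 0), (0, -1), (1, -1)]

theorem dir_injective : Function.Injective dir := by decide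

theorem dir_add_three (k : Fin 6) : dir (k + 3) = -dir k := by
  revert k; decide

theorem dir_add_two (k : Fin 6) : dir (k + 2) = dir (k + 1) - dir k := by
  revert k; decide

theorem adj_add_dir (p : ℤ × ℤ) (k : Fin 6) : triLattice.Adj p (p + dir k) := by
  have : ∀ k, (dir k).1 ^ 2 + (dir k).1 * (dir k).2 + (dir k).2 ^ 2 = 1 := by decide
  change (p.1 - (p.1 + (dir k).1)) ^ 2 + (p.1 - (p.1 + (dir k).1)) * (p.2 - (p.2 + (dir k).2))
    + (p.2 - (p.2 + (dir k).2)) ^ 2 = 1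
  linarith [this k]

theorem adj_iff_exists_dir {p q : ℤ × ℤ} : triLattice.Adj p q ↔ ∃ k, q = p + dir k := by
  refine ⟨fun h => ?_, ?_⟩
  · obtain ⟨a, b⟩ := p
    obtain ⟨c, d⟩ := q
    change (a - c) ^ 2 + (a - c) * (b - d) + (b - d) ^ 2 = 1 at h
    obtain ⟨x, rfl⟩ : ∃ x, c = a + x := ⟨c - a, by ring⟩
    obtain ⟨y, rfl⟩ : ∃ y, d = b + y := ⟨d - b, by ring⟩
    have h' : x ^ 2 + x * y + y ^ 2 = 1 := by linarith
    have hx1 : x ≤ 1 := by nlinarith [sq_nonneg (x + 2 * y)]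
    have hx2 : -1 ≤ x := by nlinarith [sq_nonneg (x + 2 * y)]
    have hy1 : y ≤ 1 := by nlinarith [sq_nonneg (2 * x + y)]
    have hy2 : -1 ≤ y := by nlinarith [sq_nonneg (2 * x + y)]
    have key : ∀ k, (x, y) = dir k → ∃ k, (a + x, b + y) = (a, b) + dir k :=
      fun k hk => ⟨k, by rw [← hk]; rfl⟩
    interval_cases x <;> interval_cases y <;> first
      | omega
      | exact key 0 rfl
      | exact key 1 rfl
      | exact key 2 rfl
      | exact key 3 rfl
      | exact key 4 rfl
      | exact key 5 rfl
  · rintro ⟨k, rfl⟩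
    exact adj_add_dir p k

theorem adj_add_left {p a b : ℤ × ℤ} : triLattice.Adj (p + a) (p + b) ↔ triLattice.Adj a b := by
  simp [triLattice]

theorem adj_dir_iff {i j : Fin 6} : triLattice.Adj (dir i) (dir j) ↔ j = i + 1 ∨ i = j + 1 := by
  revert i j
  unfold triLattice
  decide

theorem adj_add_dir_iff {p : ℤ × ℤ} {i j : Fin 6} :
    triLattice.Adj (p + dir i) (p + dir j) ↔ j = i + 1 ∨ i = j + 1 :=
  adj_add_left.trans adj_dir_iff

/-! ### Domains as sets of vertices -/

variable {G : Sub} {p q : ℤ × ℤ} {k : Fin 6}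

theorem sphere_one_adj {a b : ℤ × ℤ} :
    (sphere G p 1).Adj a b ↔ G.Adj p a ∧ G.Adj p b ∧ G.Adj a b := by
  simp only [sphere, SimpleGraph.Subgraph.induce, Set.mem_ofPred_eq, Nat.cast_one,
    SimpleGraph.edist_eq_one_iff_adj, SimpleGraph.Subgraph.spanningCoe_adj]
  exact ⟨fun h => ⟨h.1.2, h.2.1.2, h.2.2⟩,
    fun h => ⟨⟨h.1.snd_mem, h.1⟩, ⟨h.2.1.snd_mem, h.2.1⟩, h.2.2⟩⟩

theorem mem_sphere_one : q ∈ (sphere G p 1).verts ↔ G.Adj p q := by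
  simp only [sphere, SimpleGraph.Subgraph.induce, Set.mem_ofPred_eq, Nat.cast_one,
    SimpleGraph.edist_eq_one_iff_adj, SimpleGraph.Subgraph.spanningCoe_adj]
  exact ⟨fun h => h.2, fun h => ⟨h.snd_mem, h⟩⟩

theorem pointDim_one_iff : PointDim 1 G p ↔
    (∃ q, G.Adj p q) ∧ ∀ a b, G.Adj p a → G.Adj p b → ¬ G.Adj a b := by
  simp only [PointDim, Set.Nonempty, mem_sphere_one, sphere_one_adj]
  grind

theorem IsDomain.adj_iff (h : IsDomain G) :
    G.Adj p q ↔ p ∈ G.verts ∧ q ∈ G.verts ∧ triLattice.Adj p q :=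
  ⟨fun e => ⟨e.fst_mem, e.snd_mem, e.adj_sub⟩, fun e => h.edges p e.1 q e.2.1 e.2.2⟩

theorem IsDomain.adj_dir_iff (h : IsDomain G) (hp : p ∈ G.verts) :
    G.Adj p (p + dir k) ↔ p + dir k ∈ G.verts := by
  simp [h.adj_iff, hp, adj_add_dir]

theorem IsDomain.mem_interior_iff (h : IsDomain G) :
    p ∈ interior G ↔ p ∈ G.verts ∧ ∀ k, p + dir k ∈ G.verts := by
  refine and_congr_right fun hp => ⟨fun e k => ?_, fun e => ?_⟩
  · have : p + dir k ∈ (sphere ⊤ p 1).verts := mem_sphere_one.2 (adj_add_dir p k)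
    rw [← e, mem_sphere_one] at this
    exact this.snd_mem
  · have key : ∀ q, G.Adj p q ↔ triLattice.Adj p q := fun q =>
      ⟨fun hq => hq.adj_sub, fun hq => by
        obtain ⟨k, rfl⟩ := adj_iff_exists_dir.1 hq
        exact (h.adj_dir_iff hp).2 (e k)⟩
    ext a b
    · simp only [mem_sphere_one, SimpleGraph.Subgraph.top_adj, key]
    · simp only [sphere_one_adj, SimpleGraph.Subgraph.top_adj, key]
      refine and_congr_right fun ha => and_congr_right fun hb => ?_
      simp only [h.adj_iff, ((key a).2 ha).snd_mem, ((key b).2 hb).snd_mem, true_and]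

/-- In a domain the condition that a boundary vertex be adjacent to an interior vertex is
automatic. -/
theorem IsDomain.mem_boundary_iff (h : IsDomain G) :
    p ∈ boundary G ↔ p ∈ G.verts ∧ p ∉ interior G :=
  ⟨fun e => ⟨e.1, e.2.1⟩, fun e => (h.interior_or_boundary p e.1).resolve_left e.2⟩

/-- No neighbour is isolated in a unit sphere. -/
theorem IsDomain.succ_or_pred_mem (h : IsDomain G) (hp : p ∈ G.verts)
    (hk : p + dir k ∈ G.verts) : p + dir (k + 1) ∈ G.verts ∨ p + dir (k - 1) ∈ G.verts := by
  have h1 := (h.two_dim p hp).2 _ (mem_sphere_one.2 ((h.adj_dir_iff hp).2 hk))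
  obtain ⟨r, hr⟩ := (pointDim_one_iff.1 h1).1
  rw [sphere_one_adj] at hr
  obtain ⟨j, rfl⟩ := adj_iff_exists_dir.1 hr.2.1.adj_sub
  rcases adj_add_dir_iff.1 hr.2.2.adj_sub with rfl | rfl
  · exact Or.inl hr.2.1.snd_mem
  · right
    rw [add_sub_cancel_right]
    exact hr.2.1.snd_mem

/-- Boundary vertices adjacent to `p` are never adjacent to each other. -/
theorem IsDomain.not_boundary_succ (h : IsDomain G) (hp : p ∈ boundary G)
    (hk : p + dir k ∈ boundary G) : p + dir (k + 1) ∉ boundary G := by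
  intro hk'
  have h1 := (pointDim_one_iff.1 (h.boundary_one_dim p hp)).2
  refine h1 (p + dir k) (p + dir (k + 1)) ⟨hp, hk, (h.adj_dir_iff hp.1).2 hk.1⟩
    ⟨hp, hk', (h.adj_dir_iff hp.1).2 hk'.1⟩ ⟨hk, hk', h.edges _ hk.1 _ hk'.1 ?_⟩
  exact adj_add_dir_iff.2 (Or.inl rfl)

theorem exists_dir_of_mem_boundary (hp : p ∈ boundary G) : ∃ k, p + dir k ∈ interior G := by
  obtain ⟨q, hq, hpq⟩ := hp.2.2
  obtain ⟨k, rfl⟩ := adj_iff_exists_dir.1 hpq.adj_sub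
  exact ⟨k, hq⟩

/-- Two interior neighbours of a boundary vertex `p` that are one step apart on its unit sphere
have only `p` and the vertex between them as common neighbours. -/
theorem IsDomain.interior_between (h : IsDomain G) (hp : p ∈ boundary G)
    (hk : p + dir k ∈ interior G) (hk' : p + dir (k + 2) ∈ interior G) :
    p + dir (k + 1) ∈ interior G := by
  have hne : p + dir k ≠ p + dir (k + 2) := fun e => by
    have hk : k = k + 2 := dir_injective (add_left_cancel e)
    clear * - hk
    revert k
    decide
  have hnadj : ¬ triLattice.Adj (p + dir k) (p + dir (k + 2)) := by
    rw [adj_add_dir_iff]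
    clear * -
    revert k
    decide
  rcases h.common_boundary _ hk _ hk' hne
    ⟨p, hp, ((h.adj_dir_iff hp.1).2 hk.1).symm, ((h.adj_dir_iff hp.1).2 hk'.1).symm⟩ with
    e | ⟨r, hr, e1, e2⟩
  · exact absurd e.adj_sub hnadj
  · obtain ⟨i, rfl⟩ := adj_iff_exists_dir.1 e1.adj_sub
    obtain ⟨j, hj⟩ := adj_iff_exists_dir.1 e2.adj_sub
    have hj' : dir k + dir i = dir (k + 2) + dir j := by
      rw [add_assoc, add_assoc] at hj
      exact add_left_cancel hj
    have key : ∀ k i j, dir k + dir i = dir (k + 2) + dir j →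
        dir k + dir i = 0 ∨ dir k + dir i = dir (k + 1) := by decide
    rw [add_assoc] at hr
    rcases key k i j hj' with e | e <;> rw [e] at hr
    · rw [add_zero] at hr
      exact absurd hr hp.2.1
    · exact hr

/-! ### The shape of a unit sphere at a boundary vertex -/

open Classical in
/-- The indicator of a proposition as an integer. -/
noncomputable def ind (P : Prop) : ℤ := if P then 1 else 0

theorem ind_true : ind True = 1 := by simp [ind]

theorem ind_false : ind False = 0 := by simp [ind]

/-- What happens in the ball of radius two around a boundary vertex `p`, as seen from `p`:
`s k`, `u k`, `w k` say that the points `p + dir k`, `p + 2 dir k`, `p + dir k + dir (k + 1)`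
belong to the domain, and `t k` that `p + dir k` is an interior vertex. The fields `left` and
`right` say that the points `p + dir k + dir (k ± 1)` are not isolated in the unit sphere of
`p + dir k`. -/
structure Pattern (s t u w : Fin 6 → Prop) : Prop where
  interior_iff : ∀ k, t k ↔ s k ∧ s (k + 1) ∧ s (k - 1) ∧ u k ∧ w k ∧ w (k - 1)
  exists_interior : ∃ k, t k
  exists_not : ∃ k, ¬ s k
  succ_or_pred : ∀ k, s k → s (k + 1) ∨ s (k - 1)
  boundary_apart : ∀ k, s k → ¬ t k → s (k + 1) → t (k + 1)
  between : ∀ k, t k → t (k + 2) → t (k + 1)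
  left : ∀ k, s k → w k → u k ∨ s (k + 1)
  right : ∀ k, s k → w (k - 1) → u k ∨ s (k - 1)

/-- The conclusions about a pattern: there are two boundary neighbours, the unit sphere is a path,
and the curvature is the sum of `4 - deg` over the two boundary neighbours. The degree of
`p + dir k` counts `p` itself and the five other neighbours. -/
structure PatternCount (s t u w : Fin 6 → Prop) : Prop where
  boundary : ∑ k, ind (s k ∧ ¬ t k) = 2
  path : ∑ k, ind (s k ∧ s (k + 1)) = ∑ k, ind (s k) - 1
  curv : 2 * ∑ k, ind (s k ∧ s (k + 1)) -
      ∑ k, (ind ((u k ∧ s k) ∧ (w k ∧ (s k ∨ s (k + 1)))) +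
        ind ((w k ∧ (s k ∨ s (k + 1))) ∧ (u (k + 1) ∧ s (k + 1)))) =
    ∑ k, ind (s k ∧ ¬ t k) *
      (4 - (1 + ind (s (k + 1)) + ind (s (k - 1)) + ind (w k) + ind (w (k - 1)) + ind (u k)))

theorem Pattern.rotate {s t u w : Fin 6 → Prop} (h : Pattern s t u w) (i : Fin 6) :
    Pattern (fun k => s (i + k)) (fun k => t (i + k)) (fun k => u (i + k))
      (fun k => w (i + k)) where
  interior_iff k := by simpa only [add_assoc, add_sub_assoc] using h.interior_iff (i + k)
  exists_interior := by
    obtain ⟨k, hk⟩ := h.exists_interior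
    exact ⟨k - i, by simpa using hk⟩
  exists_not := by
    obtain ⟨k, hk⟩ := h.exists_not
    exact ⟨k - i, by simpa using hk⟩
  succ_or_pred k := by simpa only [add_assoc, add_sub_assoc] using h.succ_or_pred (i + k)
  boundary_apart k := by simpa only [add_assoc, add_sub_assoc] using h.boundary_apart (i + k)
  between k := by simpa only [add_assoc, add_sub_assoc] using h.between (i + k)
  left k := by simpa only [add_assoc, add_sub_assoc] using h.left (i + k)
  right k := by simpa only [add_assoc, add_sub_assoc] using h.right (i + k)

theorem PatternCount.of_rotate {s t u w : Fin 6 → Prop} (i : Fin 6)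
    (h : PatternCount (fun k => s (i + k)) (fun k => t (i + k)) (fun k => u (i + k))
      (fun k => w (i + k))) : PatternCount s t u w where
  boundary := by
    rw [← h.boundary, ← Equiv.sum_comp (Equiv.addLeft i)]
    rfl
  path := by
    have h1 := h.path
    rw [← Equiv.sum_comp (Equiv.addLeft i), ← Equiv.sum_comp (Equiv.addLeft i) (fun k => ind (s k))]
    simpa only [Equiv.coe_addLeft, add_assoc, add_sub_assoc] using h1
  curv := by
    have h1 := h.curv
    simp only [← Equiv.sum_comp (Equiv.addLeft i) (fun k => ind (s k ∧ s (k + 1))),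
      ← Equiv.sum_comp (Equiv.addLeft i)
        (fun k => (ind ((u k ∧ s k) ∧ (w k ∧ (s k ∨ s (k + 1)))) +
          ind ((w k ∧ (s k ∨ s (k + 1))) ∧ (u (k + 1) ∧ s (k + 1))))),
      ← Equiv.sum_comp (Equiv.addLeft i) (fun k => ind (s k ∧ ¬ t k) *
      (4 - (1 + ind (s (k + 1)) + ind (s (k - 1)) + ind (w k) + ind (w (k - 1)) + ind (u k))))]
    simpa only [Equiv.coe_addLeft, add_assoc, add_sub_assoc] using h1

/-- The case in which the arc of neighbours starts in direction `0`. -/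
theorem Pattern.count_of_start {s t u w : Fin 6 → Prop} (h : Pattern s t u w) (h0 : s 0)
    (h5 : ¬ s 5) : PatternCount s t u w := by
  obtain ⟨hi, -, -, hs, hb, hm, hl, hr⟩ := h
  have e5 : (-1 : Fin 6) = 5 := rfl
  -- the first neighbour is a boundary vertex, so the second one is interior
  have ht0 : ¬ t 0 := fun h => h5 ((hi 0).1 h).2.2.1
  have ht5 : ¬ t 5 := fun h => h5 ((hi 5).1 h).1
  have ht4 : ¬ t 4 := fun h => h5 ((hi 4).1 h).2.1
  have h1 : s 1 := (hs 0 h0).resolve_right h5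
  have ht1 : t 1 := hb 0 h0 ht0 h1
  obtain ⟨-, h2, -, hu1, hw1, hw0⟩ : s 1 ∧ s 2 ∧ s 0 ∧ u 1 ∧ w 1 ∧ w 0 := (hi 1).1 ht1
  have hw5 : w 5 → u 0 := fun h => (hr 0 h0 h).resolve_right h5
  -- the arc has five, four or three vertices; an end `a` of the arc has, next to its neighbour
  -- outside the domain, at most two further neighbours, and the second requires the first
  by_cases h3 : s 3
  · have ht2 : t 2 := by
      by_contra ht2
      have ht3 : t 3 := hb 2 h2 ht2 h3
      exact ht2 (hm 1 ht1 ht3)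
    obtain ⟨-, -, -, hu2, hw2, -⟩ : s 2 ∧ s 3 ∧ s 1 ∧ u 2 ∧ w 2 ∧ w 1 := (hi 2).1 ht2
    by_cases h4 : s 4
    · have ht3 : t 3 := by
        by_contra ht3
        exact ht4 (hb 3 h3 ht3 h4)
      obtain ⟨-, -, -, hu3, hw3, -⟩ : s 3 ∧ s 4 ∧ s 2 ∧ u 3 ∧ w 3 ∧ w 2 := (hi 3).1 ht3
      have hw4 : w 4 → u 4 := fun h => (hl 4 h4 h).resolve_right h5
      clear hi hs hb hm hl hr
      refine ⟨?_, ?_, ?_⟩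
      · simp [Fin.sum_univ_six, ind_true, ind_false, *]
      · simp [Fin.sum_univ_six, ind_true, ind_false, *]
      · simp only [Fin.sum_univ_six, zero_sub, e5, zero_add, Fin.reduceAdd, Fin.reduceSub]
        simp only [h0, h1, h2, h3, h4, h5, ht0, ht1, ht2, ht3, ht4, ht5, hw0, hw1, hu1, hu2, hw2, hu3, hw3,
          and_true, true_and, and_false, false_and, or_true, or_false, not_true,
          not_false_iff, ind_true, ind_false]
        by_cases hw : w 5
        · by_cases hw' : w 4
          · simp only [hw, hw', hw5 hw, hw4 hw', and_true, ind_true]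
            norm_num
          · simp only [hw, hw', hw5 hw, and_false, and_true, ind_true, ind_false]
            ring
        · by_cases hw' : w 4
          · simp only [hw, hw', hw4 hw', false_and, and_true, ind_true, ind_false]
            ring
          · simp only [hw, hw', false_and, and_false, ind_false]
            ring
    · have ht3 : ¬ t 3 := fun h => h4 ((hi 3).1 h).2.1
      have hw3 : w 3 → u 3 := fun h => (hl 3 h3 h).resolve_right h4
      clear hi hs hb hm hl hr
      refine ⟨?_, ?_, ?_⟩
      · simp [Fin.sum_univ_six, ind_true, ind_false, *]
      · simp [Fin.sum_univ_six, ind_true, ind_false, *]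
      · simp only [Fin.sum_univ_six, zero_sub, e5, zero_add, Fin.reduceAdd, Fin.reduceSub]
        simp only [h0, h1, h2, h3, h4, h5, ht0, ht1, ht2, ht3, ht4, ht5, hw0, hw1, hu1, hu2, hw2,
          and_true, true_and, and_false, false_and, or_true, or_false, not_true,
          not_false_iff, ind_true, ind_false]
        by_cases hw : w 5
        · by_cases hw' : w 3
          · simp only [hw, hw', hw5 hw, hw3 hw', and_true, ind_true]
            norm_num
          · simp only [hw, hw', hw5 hw, and_false, and_true, ind_true, ind_false]
            ring
        · by_cases hw' : w 3
          · simp only [hw, hw', hw3 hw', false_and, and_true, ind_true, ind_false]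
            ring
          · simp only [hw, hw', false_and, and_false, ind_false]
            ring
  · have h4 : ¬ s 4 := fun h4 => (hs 4 h4).elim h5 h3
    have ht2 : ¬ t 2 := fun h => h3 ((hi 2).1 h).2.1
    have ht3 : ¬ t 3 := fun h => h3 ((hi 3).1 h).1
    have hw2 : w 2 → u 2 := fun h => (hl 2 h2 h).resolve_right h3
    clear hi hs hb hm hl hr
    refine ⟨?_, ?_, ?_⟩
    · simp [Fin.sum_univ_six, ind_true, ind_false, *]
    · simp [Fin.sum_univ_six, ind_true, ind_false, *]
    · simp only [Fin.sum_univ_six, zero_sub, e5, zero_add, Fin.reduceAdd, Fin.reduceSub]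
      simp only [h0, h1, h2, h3, h4, h5, ht0, ht1, ht2, ht3, ht4, ht5, hw0, hw1, hu1, 
        and_true, true_and, and_false, false_and, or_true, or_false, not_true,
        not_false_iff, ind_true, ind_false]
      by_cases hw : w 5
      · by_cases hw' : w 2
        · simp only [hw, hw', hw5 hw, hw2 hw', and_true, ind_true]
          norm_num
        · simp only [hw, hw', hw5 hw, and_false, and_true, ind_true, ind_false]
          ring
      · by_cases hw' : w 2
        · simp only [hw, hw', hw2 hw', false_and, and_true, ind_true, ind_false]
          ring
        · simp only [hw, hw', false_and, and_false, ind_false]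
          ring

theorem Pattern.count {s t u w : Fin 6 → Prop} (h : Pattern s t u w) : PatternCount s t u w := by
  obtain ⟨i, hi, hi'⟩ : ∃ i, s i ∧ ¬ s (i + 5) := by
    -- otherwise stepping back through the hexagon, `5 = -1`, never leaves the domain
    by_contra! hc
    obtain ⟨k, hk⟩ := h.exists_interior
    obtain ⟨j, hj⟩ := h.exists_not
    have h0 := ((h.interior_iff k).1 hk).1
    have : ∀ n : ℕ, s (k + n • 5) := by
      intro n
      induction n with
      | zero => simpa using h0
      | succ n ih =>
        have := hc _ ih
        rw [succ_nsmul, ← add_assoc]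
        exact this
    have e : ∀ k j : Fin 6, k + (k - j).val • 5 = j := by decide
    exact hj (e k j ▸ this _)
  exact .of_rotate i ((h.rotate i).count_of_start (by simpa using hi) hi')

/-! ### Arc lengths of spheres -/

theorem ind_eq_ite (P : Prop) [Decidable P] : ind P = if P then 1 else 0 := by
  by_cases h : P <;> simp [ind, h]

theorem sum_ind {ι : Type*} (s : Finset ι) (P : ι → Prop) [DecidablePred P] :
    ∑ i ∈ s, ind (P i) = (s.filter P).card := by
  simp [ind_eq_ite]

/-- A full subgraph on some vertices of an induced cycle `p + c j` of the lattice has as many edges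
as there are pairs of consecutive vertices. -/
theorem arcLength_eq_of_cycle {n : ℕ} [NeZero n] (h2 : (1 + 1 : Fin n) ≠ 0)
    {c : Fin n → ℤ × ℤ} (hc : Function.Injective c)
    (hadj : ∀ i j, triLattice.Adj (c i) (c j) ↔ j = i + 1 ∨ i = j + 1) {H : Sub}
    (hv : ∀ q ∈ H.verts, ∃ j, q = p + c j)
    (hfull : ∀ a ∈ H.verts, ∀ b ∈ H.verts, triLattice.Adj a b → H.Adj a b) :
    arcLength H = ∑ j, ind (p + c j ∈ H.verts ∧ p + c (j + 1) ∈ H.verts) := by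
  classical
  have himg : H.edgeSet = (fun j => s(p + c j, p + c (j + 1))) ''
      (↑(Finset.univ.filter fun j => p + c j ∈ H.verts ∧ p + c (j + 1) ∈ H.verts) :
        Set (Fin n)) := by
    ext e
    induction e with | _ a b =>
    simp only [SimpleGraph.Subgraph.mem_edgeSet, Set.mem_image, Finset.coe_filter,
      Finset.mem_univ, true_and, Set.mem_ofPred_eq]
    constructor
    · intro h
      obtain ⟨i, rfl⟩ := hv a h.fst_mem
      obtain ⟨j, rfl⟩ := hv b h.snd_mem
      rcases (hadj i j).1 (adj_add_left.1 h.adj_sub) with rfl | rfl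
      · exact ⟨i, ⟨h.fst_mem, h.snd_mem⟩, rfl⟩
      · exact ⟨j, ⟨h.snd_mem, h.fst_mem⟩, Sym2.eq_swap⟩
    · rintro ⟨j, ⟨h, h'⟩, e⟩
      rw [← SimpleGraph.Subgraph.mem_edgeSet, ← e, SimpleGraph.Subgraph.mem_edgeSet]
      exact hfull _ h _ h' (adj_add_left.2 ((hadj _ _).2 (Or.inl rfl)))
  have hinj : Function.Injective fun j => s(p + c j, p + c (j + 1)) := by
    intro i j h
    rcases Sym2.eq_iff.1 h with h | h
    · exact hc (add_left_cancel h.1)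
    · have e1 := hc (add_left_cancel h.1)
      have e2 := hc (add_left_cancel h.2)
      rw [e1, add_assoc] at e2
      exact absurd (add_eq_left.1 e2) h2
  rw [arcLength, himg, Set.ncard_image_of_injective _ hinj, Set.ncard_coe_finset, sum_ind]

theorem arcLength_sphere_one (h : IsDomain G) (hp : p ∈ G.verts) : arcLength (sphere G p 1) =
    ∑ k, ind (p + dir k ∈ G.verts ∧ p + dir (k + 1) ∈ G.verts) := by
  rw [arcLength_eq_of_cycle (p := p) (by decide) dir_injective (fun _ _ => adj_dir_iff)]
  · simp only [mem_sphere_one, h.adj_dir_iff hp]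
  · intro q hq
    exact adj_iff_exists_dir.1 (mem_sphere_one.1 hq).adj_sub
  · intro a ha b hb hab
    rw [mem_sphere_one] at ha hb
    exact sphere_one_adj.2 ⟨ha, hb, h.edges _ ha.snd_mem _ hb.snd_mem hab⟩

/-- The twelve points at lattice distance two from the origin, in counterclockwise order;
`ring (2 k)` is `2 dir k` and `ring (2 k + 1)` is `dir k + dir (k + 1)`. -/
def ring : Fin 12 → ℤ × ℤ :=
  ![(2, 0), (1, 1), (0, 2), (-1, 2), (-2, 2), (-2, 1), (-2, 0), (-1, -1), (0, -2), (1, -2),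
    (2, -2), (2, -1)]

theorem ring_injective : Function.Injective ring := by decide

theorem ring_adj_iff (i j : Fin 12) :
    triLattice.Adj (ring i) (ring j) ↔ j = i + 1 ∨ i = j + 1 := by
  revert i j
  unfold triLattice
  decide

theorem ring_ne_zero (j : Fin 12) : ring j ≠ 0 := by
  revert j; decide

theorem ring_ne_dir (j : Fin 12) (k : Fin 6) : ring j ≠ dir k := by
  revert j k; decide

theorem dir_add_dir (i j : Fin 6) :
    dir i + dir j = 0 ∨ (∃ k, dir i + dir j = dir k) ∨ ∃ k, dir i + dir j = ring k := by
  revert i j; decide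

theorem dir_add_dir_eq_two {i j k : Fin 6} (h : dir i + dir j = dir k + dir k) : i = k := by
  revert i j k; decide

theorem dir_add_dir_eq_mid {i j k : Fin 6} (h : dir i + dir j = dir k + dir (k + 1)) :
    i = k ∨ i = k + 1 := by
  revert i j k; decide

theorem dir_add_dir_cases (i j : Fin 6) :
    dir i + dir j = 0 ∨ (∃ k, dir i + dir j = dir k) ∨ j = i ∨ j = i + 1 ∨ i = j + 1 := by
  revert i j; decide

theorem exists_ring_of_edist_eq_two {H : SimpleGraph (ℤ × ℤ)} (hH : H ≤ triLattice)
    (hfull : ∀ k, q = p + dir k → H.Adj p q) (h : H.edist p q = 2) : ∃ j, q = p + ring j := by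
  obtain ⟨hne, hnadj, r, hr⟩ := SimpleGraph.edist_eq_two_iff.1 h
  obtain ⟨i, rfl⟩ := adj_iff_exists_dir.1 (hH hr.1)
  obtain ⟨j, rfl⟩ := adj_iff_exists_dir.1 (hH hr.2.symm)
  rw [add_assoc] at hne hnadj hfull ⊢
  rcases dir_add_dir i j with e | ⟨k, e⟩ | ⟨k, e⟩ <;> rw [e] at hne hnadj hfull ⊢
  · simp at hne
  · exact absurd (hfull k rfl) hnadj
  · exact ⟨k, rfl⟩

theorem edist_eq_two_iff_of_domain (h : IsDomain G) (hp : p ∈ G.verts) (hq : q ∈ G.verts) :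
    G.spanningCoe.edist p q = 2 ↔ p ≠ q ∧ ¬ triLattice.Adj p q ∧
      ∃ i j, p + dir i ∈ G.verts ∧ q = p + dir i + dir j := by
  rw [SimpleGraph.edist_eq_two_iff, SimpleGraph.Subgraph.spanningCoe_adj, h.adj_iff]
  simp only [hp, hq, true_and]
  refine and_congr_right fun _ => and_congr_right fun _ => ⟨?_, ?_⟩
  · rintro ⟨r, hr1, hr2⟩
    change G.Adj p r at hr1
    change G.Adj q r at hr2
    obtain ⟨i, rfl⟩ := adj_iff_exists_dir.1 hr1.adj_sub
    obtain ⟨j, rfl⟩ := adj_iff_exists_dir.1 hr2.adj_sub.symm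
    exact ⟨i, j, hr1.snd_mem, rfl⟩
  · rintro ⟨i, j, hi, rfl⟩
    exact ⟨p + dir i, (h.adj_dir_iff hp).2 hi, ((h.adj_dir_iff hi).2 hq).symm⟩

theorem mem_sphere_two (h : IsDomain G) (hp : p ∈ G.verts) {j : Fin 12} :
    p + ring j ∈ (sphere G p 2).verts ↔ p + ring j ∈ G.verts ∧
      ∃ a b, p + dir a ∈ G.verts ∧ ring j = dir a + dir b := by
  refine and_congr_right fun hq => ?_
  rw [Nat.cast_ofNat, edist_eq_two_iff_of_domain h hp hq]
  simp only [add_assoc, add_right_inj]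
  refine ⟨fun h => h.2.2, fun h => ⟨?_, ?_, h⟩⟩
  · simpa using ring_ne_zero j
  · rw [adj_iff_exists_dir]
    rintro ⟨k, hk⟩
    exact ring_ne_dir j k (add_left_cancel hk)

/-- The only common neighbour of `p` and `p + 2 dir k` in the lattice is `p + dir k`. -/
theorem mem_sphere_two_corner (h : IsDomain G) (hp : p ∈ G.verts) {j : Fin 12} {k : Fin 6}
    (hj : ring j = dir k + dir k) : p + ring j ∈ (sphere G p 2).verts ↔
      p + dir k + dir k ∈ G.verts ∧ p + dir k ∈ G.verts := by
  rw [mem_sphere_two h hp, hj, add_assoc]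
  refine and_congr_right fun _ => ⟨?_, fun h => ⟨k, k, h, rfl⟩⟩
  rintro ⟨a, b, ha, e⟩
  exact dir_add_dir_eq_two e.symm ▸ ha

/-- The common neighbours of `p` and `p + dir k + dir (k + 1)` in the lattice are `p + dir k` and
`p + dir (k + 1)`. -/
theorem mem_sphere_two_mid (h : IsDomain G) (hp : p ∈ G.verts) {j : Fin 12} {k : Fin 6}
    (hj : ring j = dir k + dir (k + 1)) : p + ring j ∈ (sphere G p 2).verts ↔
      p + dir k + dir (k + 1) ∈ G.verts ∧ (p + dir k ∈ G.verts ∨ p + dir (k + 1) ∈ G.verts) := by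
  rw [mem_sphere_two h hp, hj, add_assoc]
  refine and_congr_right fun _ => ⟨?_, ?_⟩
  · rintro ⟨a, b, ha, e⟩
    rcases dir_add_dir_eq_mid e.symm with rfl | rfl
    · exact Or.inl ha
    · exact Or.inr ha
  · rintro (h | h)
    · exact ⟨k, k + 1, h, rfl⟩
    · exact ⟨k + 1, k, h, add_comm _ _⟩

theorem arcLength_sphere_two (h : IsDomain G) (hp : p ∈ G.verts) :
    arcLength (sphere G p 2) = ∑ k,
      (ind ((p + dir k + dir k ∈ G.verts ∧ p + dir k ∈ G.verts) ∧
        (p + dir k + dir (k + 1) ∈ G.verts ∧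
          (p + dir k ∈ G.verts ∨ p + dir (k + 1) ∈ G.verts))) +
      ind ((p + dir k + dir (k + 1) ∈ G.verts ∧
          (p + dir k ∈ G.verts ∨ p + dir (k + 1) ∈ G.verts)) ∧
        (p + dir (k + 1) + dir (k + 1) ∈ G.verts ∧ p + dir (k + 1) ∈ G.verts))) := by
  rw [arcLength_eq_of_cycle (p := p) (by decide) ring_injective ring_adj_iff]
  · -- pair up the twelve edges of the ring according to the sector `k` they lie in
    have hsum : ∀ f : Fin 12 → ℤ, ∑ j, f j = ∑ k : Fin 6,
        (f ⟨2 * k, by omega⟩ + f ⟨2 * k + 1, by omega⟩) := by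
      intro f
      rw [← (finProdFinEquiv : Fin 6 × Fin 2 ≃ Fin 12).sum_comp, Fintype.sum_prod_type]
      refine Finset.sum_congr rfl fun k _ => ?_
      rw [Fin.sum_univ_two]
      congr 2 <;> ext <;> simp [finProdFinEquiv, add_comm]
    rw [hsum]
    refine Finset.sum_congr rfl fun k _ => ?_
    have e0 : ∀ k : Fin 6, ring ⟨2 * k, by omega⟩ = dir k + dir k := by decide
    have e1 : ∀ k : Fin 6, ring ⟨2 * k + 1, by omega⟩ = dir k + dir (k + 1) := by decide
    have e1' : ∀ k : Fin 6, ring (⟨2 * k, by omega⟩ + 1) = dir k + dir (k + 1) := by decide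
    have e2 : ∀ k : Fin 6, ring (⟨2 * k + 1, by omega⟩ + 1) = dir (k + 1) + dir (k + 1) := by
      decide
    rw [mem_sphere_two_corner h hp (e0 k), mem_sphere_two_mid h hp (e1' k),
      mem_sphere_two_mid h hp (e1 k), mem_sphere_two_corner h hp (e2 k)]
  · intro q hq
    refine exists_ring_of_edist_eq_two G.spanningCoe_le (fun k e => ?_) hq.2
    rw [e] at hq ⊢
    exact (h.adj_dir_iff hp).2 hq.1
  · intro a ha b hb hab
    exact ⟨ha, hb, h.edges _ ha.1 _ hb.1 hab⟩

/-! ### Spheres measured with the distance of the lattice -/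

theorem latticeSphere_one (h : IsDomain G) (hp : p ∈ G.verts) :
    latticeSphere G p 1 = sphere G p 1 := by
  unfold latticeSphere sphere
  congr 1
  ext q
  refine and_congr_right fun hq => ?_
  rw [Nat.cast_one, SimpleGraph.edist_eq_one_iff_adj, SimpleGraph.edist_eq_one_iff_adj,
    SimpleGraph.Subgraph.spanningCoe_adj, h.adj_iff]
  simp [hp, hq]

theorem add_dir_add_dir_add_three (r : ℤ × ℤ) (k : Fin 6) : r + dir k + dir (k + 3) = r := by
  rw [dir_add_three, add_neg_cancel_right]

theorem add_dir_add_dir_add_two (r : ℤ × ℤ) (k : Fin 6) :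
    r + dir k + dir (k + 2) = r + dir (k + 1) := by
  rw [dir_add_two, add_assoc, add_sub_cancel]

theorem add_dir_add_dir_sub_two (r : ℤ × ℤ) (k : Fin 6) :
    r + dir k + dir (k - 2) = r + dir (k - 1) := by
  rw [add_assoc]
  congr 1
  revert k
  decide

/-- A boundary vertex of a domain has three consecutive neighbours in the domain, so it cannot miss
two opposite neighbours. -/
theorem IsDomain.mem_or_opposite_mem (h : IsDomain G) (hp : p ∈ G.verts) (i : Fin 6) :
    p + dir i ∈ G.verts ∨ p + dir (i + 3) ∈ G.verts := by
  rcases h.interior_or_boundary p hp with hi | hb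
  · exact Or.inl ((h.mem_interior_iff.1 hi).2 i)
  · obtain ⟨k, hk⟩ := exists_dir_of_mem_boundary hb
    obtain ⟨h0, hk⟩ := h.mem_interior_iff.1 hk
    have h1 := hk (k + 2)
    have h2 := hk (k - 2)
    rw [add_dir_add_dir_add_two] at h1
    rw [add_dir_add_dir_sub_two] at h2
    have : ∀ i k : Fin 6, (i = k ∨ i = k + 1 ∨ i = k - 1) ∨
      (i + 3 = k ∨ i + 3 = k + 1 ∨ i + 3 = k - 1) := by decide
    exact (this i k).imp (by rintro (rfl | rfl | rfl) <;> assumption)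
      (by rintro (e | e | e) <;> rw [e] <;> assumption)

/-- In a smooth domain, a vertex at lattice distance two is at geodesic distance two: if all common
neighbours lay in the complement, one of them would be isolated in a unit sphere there or would
separate two opposite points outside the complement. -/
theorem latticeSphere_two (h : IsSmoothDomain G) (hp : p ∈ G.verts) :
    latticeSphere G p 2 = sphere G p 2 := by
  obtain ⟨h, hc⟩ := h
  have hmem : ∀ {q}, q ∈ (compl G).verts ↔ q ∉ G.verts := Iff.rfl
  unfold latticeSphere sphere
  congr 1
  ext q
  refine and_congr_right fun hq => ?_
  rw [Nat.cast_ofNat, edist_eq_two_iff_of_domain h hp hq, SimpleGraph.edist_eq_two_iff]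
  refine and_congr_right fun hne => and_congr_right fun hnadj => ⟨?_, ?_⟩
  · rintro ⟨r, hr1, hr2⟩
    obtain ⟨i, rfl⟩ := adj_iff_exists_dir.1 hr1
    obtain ⟨j, rfl⟩ := adj_iff_exists_dir.1 (triLattice.adj_symm hr2)
    clear hr1 hr2
    -- were both common neighbours in the complement, `p + dir (i + 1)` would be isolated in the unit
    -- sphere of `p + dir i` there
    have mid : ∀ i, p + dir i + dir (i + 1) ∈ G.verts →
        p + dir i ∈ G.verts ∨ p + dir (i + 1) ∈ G.verts := by
      intro i hq
      by_contra! hn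
      have hk : p + dir i + dir (i + 2) ∈ (compl G).verts := by
        rw [add_dir_add_dir_add_two]
        exact hn.2
      rcases hc.succ_or_pred_mem (p := p + dir i) hn.1 hk with e | e
      · rw [add_assoc i 2 1, show (2 + 1 : Fin 6) = 3 from rfl, add_dir_add_dir_add_three] at e
        exact e hp
      · rw [add_sub_assoc, show (2 - 1 : Fin 6) = 1 from rfl] at e
        exact e hq
    rcases dir_add_dir_cases i j with e | ⟨k, e⟩ | rfl | rfl | rfl
    · rw [add_assoc, e, add_zero] at hne
      exact absurd rfl hne
    · rw [add_assoc, e] at hnadj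
      exact absurd (adj_add_dir p k) hnadj
    · refine ⟨j, j, ?_, rfl⟩
      by_contra hn
      rcases hc.mem_or_opposite_mem (p := p + dir j) hn j with e | e
      · exact e hq
      · rw [add_dir_add_dir_add_three] at e
        exact e hp
    · rcases mid i hq with e | e
      · exact ⟨i, i + 1, e, rfl⟩
      · exact ⟨i + 1, i, e, add_right_comm _ _ _⟩
    · rw [add_right_comm] at hq
      rcases mid j hq with e | e
      · exact ⟨j, j + 1, e, add_right_comm _ _ _⟩
      · exact ⟨j + 1, j, e, rfl⟩
  · rintro ⟨i, j, -, rfl⟩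
    exact ⟨p + dir i, adj_add_dir p i, (adj_add_dir _ j).symm⟩

/-! ### Curvature at a boundary vertex -/

/-- The number of neighbours of `p` in a full subgraph `G`. -/
noncomputable def degree (G : Sub) (p : ℤ × ℤ) : ℤ := ∑ k, ind (p + dir k ∈ G.verts)

/-- The number of edges of the unit sphere of `p`, that is, of triangles containing `p`, in a full
subgraph `G`. -/
noncomputable def triangles (G : Sub) (p : ℤ × ℤ) : ℤ :=
  ∑ k, ind (p + dir k ∈ G.verts ∧ p + dir (k + 1) ∈ G.verts)

theorem forall_dir_iff (P : Fin 6 → Prop) (k : Fin 6) :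
    (∀ j, P j) ↔ P k ∧ P (k + 1) ∧ P (k + 2) ∧ P (k + 3) ∧ P (k - 2) ∧ P (k - 1) := by
  refine ⟨fun h => ⟨h _, h _, h _, h _, h _, h _⟩, fun ⟨h0, h1, h2, h3, h4, h5⟩ j => ?_⟩
  have : ∀ j k : Fin 6,
    j = k ∨ j = k + 1 ∨ j = k + 2 ∨ j = k + 3 ∨ j = k - 2 ∨ j = k - 1 := by decide
  rcases this j k with rfl | rfl | rfl | rfl | rfl | rfl <;> assumption

theorem sum_dir_eq (f : Fin 6 → ℤ) (k : Fin 6) :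
    ∑ j, f j = f k + f (k + 1) + f (k + 2) + f (k + 3) + f (k - 2) + f (k - 1) := by
  rw [← Equiv.sum_comp (Equiv.addLeft k), Fin.sum_univ_six]
  have h4 : k - 2 = k + 4 := by revert k; decide
  have h5 : k - 1 = k + 5 := by revert k; decide
  simp only [Equiv.coe_addLeft, add_zero, h4, h5]

theorem add_dir_sub_one_add (p : ℤ × ℤ) (k : Fin 6) :
    p + dir (k - 1) + dir (k - 1 + 1) = p + dir k + dir (k - 1) := by
  rw [sub_add_cancel, add_right_comm]

theorem IsDomain.pattern (h : IsDomain G) (hp : p ∈ boundary G) :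
    Pattern (fun k => p + dir k ∈ G.verts) (fun k => p + dir k ∈ interior G)
      (fun k => p + dir k + dir k ∈ G.verts) (fun k => p + dir k + dir (k + 1) ∈ G.verts) where
  interior_iff k := by
    have hp' := hp.1
    simp only [h.mem_interior_iff, forall_dir_iff _ k, add_dir_add_dir_add_two,
      add_dir_add_dir_add_three, add_dir_add_dir_sub_two, add_dir_sub_one_add]
    tauto
  exists_interior := exists_dir_of_mem_boundary hp
  exists_not := by
    by_contra! hn
    exact hp.2.1 (h.mem_interior_iff.2 ⟨hp.1, hn⟩)
  succ_or_pred k := h.succ_or_pred_mem hp.1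
  boundary_apart k hs ht hs' := by
    by_contra ht'
    exact h.not_boundary_succ hp (h.mem_boundary_iff.2 ⟨hs, ht⟩) (h.mem_boundary_iff.2 ⟨hs', ht'⟩)
  between k := h.interior_between hp
  left k hs hw := by
    have := h.succ_or_pred_mem hs hw
    rw [add_assoc k, show (1 + 1 : Fin 6) = 2 from rfl, add_dir_add_dir_add_two,
      add_sub_cancel_right] at this
    exact this.symm
  right k hs hw := by
    rw [add_dir_sub_one_add] at hw
    have := h.succ_or_pred_mem hs hw
    rwa [sub_sub, show (1 + 1 : Fin 6) = 2 from rfl, add_dir_add_dir_sub_two,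
      sub_add_cancel] at this

theorem degree_add_dir (hp : p ∈ G.verts) (k : Fin 6) : degree G (p + dir k) =
    1 + ind (p + dir (k + 1) ∈ G.verts) + ind (p + dir (k - 1) ∈ G.verts) +
      ind (p + dir k + dir (k + 1) ∈ G.verts) +
      ind (p + dir (k - 1) + dir (k - 1 + 1) ∈ G.verts) + ind (p + dir k + dir k ∈ G.verts) := by
  have h1 : ind (p ∈ G.verts) = 1 := by simp [ind, hp]
  rw [degree, sum_dir_eq _ k]
  simp only [add_dir_add_dir_add_two, add_dir_add_dir_add_three, add_dir_add_dir_sub_two,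
    add_dir_sub_one_add, h1]
  ring

theorem IsDomain.sum_boundary (h : IsDomain G) (hp : p ∈ boundary G) :
    ∑ k, ind (p + dir k ∈ boundary G) = 2 := by
  simpa only [h.mem_boundary_iff] using (h.pattern hp).count.boundary

theorem IsDomain.triangles_eq (h : IsDomain G) (hp : p ∈ boundary G) :
    triangles G p = degree G p - 1 :=
  (h.pattern hp).count.path

/-- The curvature at a boundary vertex is carried by its two neighbours on the boundary. -/
theorem IsDomain.curvature_eq (h : IsDomain G) (hp : p ∈ boundary G) :
    curvature G p = ∑ k, ind (p + dir k ∈ boundary G) * (4 - degree G (p + dir k)) := by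
  rw [curvature, arcLength_sphere_one h hp.1, arcLength_sphere_two h hp.1]
  simp only [degree_add_dir hp.1, h.mem_boundary_iff]
  exact (h.pattern hp).count.curv

theorem latticeCurvature_eq (h : IsSmoothDomain G) (hp : p ∈ G.verts) :
    latticeCurvature G p = curvature G p := by
  rw [latticeCurvature, curvature, latticeSphere_one h.1 hp, latticeSphere_two h hp]

/-! ### Summation over the domain -/

theorem sum_ind_mul_add (B : Finset (ℤ × ℤ)) (v : ℤ × ℤ) (f : ℤ × ℤ → ℤ) :
    ∑ p ∈ B, ind (p + v ∈ B) * f (p + v) = ∑ q ∈ B, ind (q - v ∈ B) * f q := by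
  simp only [ind_eq_ite, ite_mul, one_mul, zero_mul, ← Finset.sum_filter]
  refine Finset.sum_nbij' (· + v) (· - v) ?_ ?_ ?_ ?_ ?_ <;> simp +contextual

/-- Moving a function from each vertex of a finite set to all of its neighbours in that set
multiplies it by the number of these neighbours. -/
theorem sum_sum_neighbours (B : Finset (ℤ × ℤ)) (f : ℤ × ℤ → ℤ) :
    ∑ p ∈ B, ∑ k, ind (p + dir k ∈ B) * f (p + dir k) =
      ∑ q ∈ B, (∑ k, ind (q + dir k ∈ B)) * f q := by
  rw [Finset.sum_comm]
  simp only [sum_ind_mul_add, Finset.sum_mul]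
  rw [Finset.sum_comm]
  refine Finset.sum_congr rfl fun q _ => ?_
  rw [← Equiv.sum_comp (Equiv.addRight (3 : Fin 6)) (fun k => ind (q + dir k ∈ B) * f q)]
  simp only [Equiv.coe_addRight, dir_add_three, sub_eq_add_neg]

/-- Each edge has two end points. -/
theorem two_mul_ncard_edgeSet (h : IsDomain G) (hfin : G.verts.Finite) :
    2 * (G.edgeSet.ncard : ℤ) = ∑ p ∈ hfin.toFinset, degree G p := by
  classical
  have hE : G.edgeSet.Finite := by
    refine ((hfin.prod hfin).image fun x => s(x.1, x.2)).subset fun e he => ?_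
    induction e with | _ a b =>
    exact ⟨(a, b), ⟨he.fst_mem, he.snd_mem⟩, rfl⟩
  have hdeg : ∀ p ∈ hfin.toFinset,
      degree G p = (hE.toFinset.bipartiteAbove (fun p e => p ∈ e) p).card := by
    intro p hp
    rw [hfin.mem_toFinset] at hp
    have himg : hE.toFinset.bipartiteAbove (fun p e => p ∈ e) p =
        (Finset.univ.filter fun k => p + dir k ∈ G.verts).image fun k => s(p, p + dir k) := by
      ext e
      simp only [Finset.mem_bipartiteAbove, hE.mem_toFinset, Finset.mem_image, Finset.mem_filter,
        Finset.mem_univ, true_and]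
      constructor
      · rintro ⟨he, q, rfl⟩
        have he' : G.Adj p q := he
        obtain ⟨k, rfl⟩ := adj_iff_exists_dir.1 he'.adj_sub
        exact ⟨k, he'.snd_mem, rfl⟩
      · rintro ⟨k, hk, rfl⟩
        exact ⟨(h.adj_dir_iff hp).2 hk, Sym2.mem_mk_left _ _⟩
    rw [himg, Finset.card_image_of_injective, degree, sum_ind]
    exact fun i j e => dir_injective (add_left_cancel (Sym2.congr_right.1 e))
  rw [Finset.sum_congr rfl hdeg, ← Nat.cast_sum,
    Finset.sum_card_bipartiteAbove_eq_sum_card_bipartiteBelow,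
    Finset.sum_congr rfl (g := fun _ => 2), Finset.sum_const, ← Set.ncard_eq_toFinset_card _ hE]
  · simp [mul_comm]
  · intro e he
    rw [hE.mem_toFinset] at he
    induction e with | _ a b =>
    rw [← Finset.card_pair (SimpleGraph.Subgraph.Adj.ne he)]
    congr 1
    ext p
    simp only [Finset.mem_bipartiteBelow, hfin.mem_toFinset, Sym2.mem_iff, Finset.mem_insert,
      Finset.mem_singleton, and_iff_right_iff_imp]
    rintro (rfl | rfl)
    exacts [he.fst_mem, he.snd_mem]

/-- Each triangle has three vertices. -/
theorem three_mul_ncard_cliqueSet (h : IsDomain G) (hfin : G.verts.Finite) :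
    3 * ((G.spanningCoe.cliqueSet 3).ncard : ℤ) = ∑ p ∈ hfin.toFinset, triangles G p := by
  classical
  have hsub : ∀ t ∈ G.spanningCoe.cliqueSet 3, t ⊆ hfin.toFinset := by
    intro t ht q hq
    obtain ⟨a, b, c, hab, hac, hbc, rfl⟩ := SimpleGraph.is3Clique_iff.1 ht
    rw [SimpleGraph.Subgraph.spanningCoe_adj] at hab hac
    simp only [Finset.mem_insert, Finset.mem_singleton] at hq
    rw [hfin.mem_toFinset]
    rcases hq with rfl | rfl | rfl
    exacts [hab.fst_mem, hab.snd_mem, hac.snd_mem]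
  have hT : (G.spanningCoe.cliqueSet 3).Finite :=
    (Finset.finite_toSet hfin.toFinset.powerset).subset fun t ht =>
      Finset.mem_coe.2 (Finset.mem_powerset.2 (hsub t ht))
  have htri : ∀ p ∈ hfin.toFinset,
      triangles G p = (hT.toFinset.bipartiteAbove (fun p t => p ∈ t) p).card := by
    intro p hp
    rw [hfin.mem_toFinset] at hp
    have himg : hT.toFinset.bipartiteAbove (fun p t => p ∈ t) p =
        (Finset.univ.filter fun k => p + dir k ∈ G.verts ∧ p + dir (k + 1) ∈ G.verts).image
          fun k => ({p, p + dir k, p + dir (k + 1)} : Finset (ℤ × ℤ)) := by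
      ext t
      simp only [Finset.mem_bipartiteAbove, hT.mem_toFinset, Finset.mem_image, Finset.mem_filter,
        Finset.mem_univ, true_and, SimpleGraph.mem_cliqueSet_iff]
      constructor
      · rintro ⟨ht, hpt⟩
        -- the two vertices of the triangle other than `p`
        obtain ⟨b, c, hb, hc, hbc, rfl⟩ : ∃ b c, G.Adj p b ∧ G.Adj p c ∧ G.Adj b c ∧
            t = {p, b, c} := by
          obtain ⟨a, b, c, hab, hac, hbc, rfl⟩ := SimpleGraph.is3Clique_iff.1 ht
          rw [SimpleGraph.Subgraph.spanningCoe_adj] at hab hac hbc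
          simp only [Finset.mem_insert, Finset.mem_singleton] at hpt
          rcases hpt with rfl | rfl | rfl
          · exact ⟨b, c, hab, hac, hbc, rfl⟩
          · exact ⟨a, c, hab.symm, hbc, hac, Finset.insert_comm _ _ _⟩
          · refine ⟨a, b, hac.symm, hbc.symm, hab, ?_⟩
            ext x
            simp only [Finset.mem_insert, Finset.mem_singleton]
            tauto
        obtain ⟨i, rfl⟩ := adj_iff_exists_dir.1 hb.adj_sub
        obtain ⟨j, rfl⟩ := adj_iff_exists_dir.1 hc.adj_sub
        rcases adj_add_dir_iff.1 hbc.adj_sub with rfl | rfl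
        · exact ⟨i, ⟨hb.snd_mem, hc.snd_mem⟩, rfl⟩
        · exact ⟨j, ⟨hc.snd_mem, hb.snd_mem⟩, congrArg _ (Finset.pair_comm _ _)⟩
      · rintro ⟨k, ⟨hk, hk'⟩, rfl⟩
        refine ⟨SimpleGraph.is3Clique_triple_iff.2 ⟨?_, ?_, ?_⟩, Finset.mem_insert_self _ _⟩
        · exact (h.adj_dir_iff hp).2 hk
        · exact (h.adj_dir_iff hp).2 hk'
        · exact h.edges _ hk _ hk' (adj_add_dir_iff.2 (Or.inl rfl))
    have hinj : Function.Injective fun k => ({0, dir k, dir (k + 1)} : Finset (ℤ × ℤ)) := by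
      decide
    rw [himg, Finset.card_image_of_injective, triangles, sum_ind]
    intro i j e
    apply hinj
    apply Finset.image_injective (add_right_injective p)
    simpa only [Finset.image_insert, Finset.image_singleton, add_zero] using e
  rw [Finset.sum_congr rfl htri, ← Nat.cast_sum,
    Finset.sum_card_bipartiteAbove_eq_sum_card_bipartiteBelow,
    Finset.sum_congr rfl (g := fun _ => 3), Finset.sum_const, ← Set.ncard_eq_toFinset_card _ hT]
  · simp [mul_comm]
  · intro t ht
    rw [hT.mem_toFinset] at ht
    rw [← (SimpleGraph.mem_cliqueSet_iff.1 ht).card_eq]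
    congr 1
    ext p
    simp only [Finset.mem_bipartiteBelow, and_iff_right_iff_imp]
    exact fun hpt => hsub t ht hpt

/-- In the sum over all vertices of `6 - 3 deg + 2 tri`, interior vertices, with six neighbours and
six triangles, cancel. -/
theorem six_mul_eulerChar (h : IsDomain G) (hfin : G.verts.Finite) (hB : (boundary G).Finite) :
    6 * eulerChar G = ∑ p ∈ hB.toFinset, (4 - degree G p) := by
  have h1 : 6 * eulerChar G =
      ∑ p ∈ hfin.toFinset, (6 - 3 * degree G p + 2 * triangles G p) := by
    rw [Finset.sum_add_distrib, Finset.sum_sub_distrib, ← Finset.mul_sum, ← Finset.mul_sum,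
      ← two_mul_ncard_edgeSet h, ← three_mul_ncard_cliqueSet h, eulerChar,
      Set.ncard_eq_toFinset_card _ hfin]
    simp
    ring
  rw [h1]
  symm
  refine Finset.sum_subset_zero_on_sdiff ?_ ?_ ?_
  · intro p hp
    simp only [Set.Finite.mem_toFinset] at hp ⊢
    exact hp.1
  · intro p hp
    simp only [Finset.mem_sdiff, Set.Finite.mem_toFinset] at hp
    have hi := (h.interior_or_boundary p hp.1).resolve_right hp.2
    rw [h.mem_interior_iff] at hi
    simp [degree, triangles, hi.2, ind_true]
  · intro p hp
    rw [h.triangles_eq ((Set.Finite.mem_toFinset _).1 hp)]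
    ring

theorem sum_curvature (h : IsDomain G) (hfin : G.verts.Finite) :
    ∑ᶠ p ∈ boundary G, curvature G p = 12 * eulerChar G := by
  have hB : (boundary G).Finite := hfin.subset fun p hp => hp.1
  have hmem : ∀ q, q ∈ boundary G ↔ q ∈ hB.toFinset := fun q => hB.mem_toFinset.symm
  calc ∑ᶠ p ∈ boundary G, curvature G p
      = ∑ p ∈ hB.toFinset, curvature G p := finsum_mem_eq_finite_toFinset_sum _ hB
    _ = ∑ p ∈ hB.toFinset,
          ∑ k, ind (p + dir k ∈ hB.toFinset) * (4 - degree G (p + dir k)) := by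
        refine Finset.sum_congr rfl fun p hp => ?_
        simp only [h.curvature_eq ((hmem p).2 hp), hmem]
    _ = ∑ q ∈ hB.toFinset, 2 * (4 - degree G q) := by
        rw [sum_sum_neighbours _ fun q => 4 - degree G q]
        refine Finset.sum_congr rfl fun q hq => ?_
        simp only [← hmem, h.sum_boundary ((hmem q).2 hq)]
    _ = 12 * eulerChar G := by
        rw [← Finset.mul_sum, ← six_mul_eulerChar h hfin hB]
        ring

end TriLattice

theorem mainTheorem2 (G : TriLattice.Sub) (hfin : G.verts.Finite) :
    (TriLattice.IsSmoothDomain G →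
      (∑ᶠ p ∈ TriLattice.boundary G, TriLattice.curvature G p) = 12 * TriLattice.eulerChar G ∧
      (∑ᶠ p ∈ TriLattice.boundary G, TriLattice.latticeCurvature G p) =
        12 * TriLattice.eulerChar G) ∧
    (TriLattice.IsDomain G → TriLattice.IsDomain (TriLattice.closedCompl G) →
      (∑ᶠ p ∈ TriLattice.boundary G, TriLattice.curvature G p) =
        12 * TriLattice.eulerChar G) := by
  refine ⟨fun h => ⟨TriLattice.sum_curvature h.1 hfin, ?_⟩,
    fun h _ => TriLattice.sum_curvature h hfin⟩
  rw [← TriLattice.sum_curvature h.1 hfin]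
  exact finsum_mem_congr rfl fun p hp => TriLattice.latticeCurvature_eq h hp.1
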